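/- Let $\Gamma=(V,E)$ be a connected simple graph with $|V|=r+1\ge 3$ vertices and $|E|=n\ge 3$ edges, and let $$F_\Gamma=\sum_{T}\prod_{i\in T}x_i\in\mathbb{R}[x_1,\dots,x_n]$$ be its Kirchhoff polynomial, with one variable $x_i$ for each edge, where $T$ runs over the (edge sets of) spanning trees of $\Gamma$. Put $$\operatorname{Ann}(F_\Gamma)=\{P\in\mathbb{R}[x_1,\dots,x_n] : P(\partial/\partial x_1,\dots,\partial/\partial x_n)F_\Gamma=0\},\qquad R_\Gamma=\mathbb{R}[x_1,\dots,x_n]/\operatorname{Ann}(F_\Gamma),$$ and let $R_\Gamma^\ell$ be the image in $R_\Gamma$ of the homogeneous polynomials of degree $\ell$. Then $R_\Gamma^r\neq 0$, $R_\Gamma^\ell=0$ for $\ell>r$, and for every $a=(a_1,\dots,a_n)\in(\mathbb{R}_{>0})^n$ the element $L_a=a_1x_1+\cdots+a_nx_n\in R_\Gamma^1$ has the strong Lefschetz property in degree one: multiplication by $L_a^{r-2}$ maps $R_\Gamma^1$ bijectively onto $R_\Gamma^{r-1}$. -/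

import Mathlib

namespace GraphLefschetz

open MvPolynomial

theorem pderiv_comm {σ : Type*} (i j : σ) (F : MvPolynomial σ ℝ) :
    pderiv i (pderiv j F) = pderiv j (pderiv i F) := by
  classical
  have h : ⁅pderiv (R := ℝ) i, pderiv (R := ℝ) j⁆ = 0 := by
    apply MvPolynomial.derivation_ext
    intro k
    rw [Derivation.commutator_apply, pderiv_X, pderiv_X]
    simp only [Pi.single_apply]
    split_ifs <;> simp
  have h2 := congrArg (fun D => D F) h
  rw [Derivation.commutator_apply] at h2
  exact sub_eq_zero.mp h2

/-- The set of the operators `∂/∂xᵢ` on `ℝ[xᵢ : i ∈ σ]`. -/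
def partials (σ : Type*) : Set (Module.End ℝ (MvPolynomial σ ℝ)) :=
  Set.range fun i : σ => (pderiv (R := ℝ) i : MvPolynomial σ ℝ →ₗ[ℝ] MvPolynomial σ ℝ)

theorem partials_comm (σ : Type*) :
    ∀ A ∈ partials σ, ∀ B ∈ partials σ, A * B = B * A := by
  rintro _ ⟨i, rfl⟩ _ ⟨j, rfl⟩
  exact LinearMap.ext fun F => pderiv_comm i j F

open scoped IsMulCommutative in
/-- The substitution `P ↦ P(∂/∂x₁, …, ∂/∂xₙ)`: the algebra homomorphism from the polynomial ring
to the linear operators on it which sends `xᵢ` to `∂/∂xᵢ`. It takes values in the commutative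
algebra that the partial derivatives generate. -/
noncomputable def diffOp (σ : Type*) :
    MvPolynomial σ ℝ →ₐ[ℝ] Module.End ℝ (MvPolynomial σ ℝ) :=
  haveI : IsMulCommutative (Algebra.adjoin ℝ (partials σ)) :=
    Algebra.isMulCommutative_adjoin ℝ (partials_comm σ)
  (Algebra.adjoin ℝ (partials σ)).val.comp
    (aeval fun i : σ => (⟨(pderiv (R := ℝ) i : MvPolynomial σ ℝ →ₗ[ℝ] MvPolynomial σ ℝ),
      Algebra.subset_adjoin ⟨i, rfl⟩⟩ : Algebra.adjoin ℝ (partials σ)))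

/-- Together with `diffOp` being an algebra homomorphism, this characterises it. -/
theorem diffOp_X {σ : Type*} (i : σ) (F : MvPolynomial σ ℝ) :
    diffOp σ (X i) F = pderiv i F := by
  simp [diffOp]

/-- `Ann(F) = {P | P(∂/∂x₁, …, ∂/∂xₙ) F = 0}`. -/
noncomputable def annIdeal {σ : Type*} (F : MvPolynomial σ ℝ) : Ideal (MvPolynomial σ ℝ) where
  carrier := {P | diffOp σ P F = 0}
  add_mem' {P Q} hP hQ := by
    change diffOp σ P F = 0 at hP
    change diffOp σ Q F = 0 at hQ
    change diffOp σ (P + Q) F = 0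
    rw [map_add, LinearMap.add_apply, hP, hQ, add_zero]
  zero_mem' := by simp
  smul_mem' Q P hP := by
    change diffOp σ P F = 0 at hP
    change diffOp σ (Q * P) F = 0
    rw [map_mul, Module.End.mul_apply, hP, map_zero]

/-- `R_F = ℝ[x₁, …, xₙ] / Ann(F)`. -/
abbrev GorensteinAlgebra {σ : Type*} (F : MvPolynomial σ ℝ) : Type _ :=
  MvPolynomial σ ℝ ⧸ annIdeal F

/-- The graded piece `R_F^ℓ`: the classes of the homogeneous polynomials of degree `ℓ`. -/
noncomputable def gradedPiece {σ : Type*} (F : MvPolynomial σ ℝ) (l : ℕ) :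
    Submodule ℝ (GorensteinAlgebra F) :=
  (homogeneousSubmodule σ ℝ l).map (Ideal.Quotient.mkₐ ℝ (annIdeal F)).toLinearMap

/-- The class `L_a` of `∑ aᵢ xᵢ` in `R_F`. -/
noncomputable def linearElement {σ : Type*} [Fintype σ] (F : MvPolynomial σ ℝ) (a : σ → ℝ) :
    GorensteinAlgebra F :=
  Ideal.Quotient.mk (annIdeal F) (∑ i, C (a i) * X i)

/-- For a graded algebra `R = R⁰ ⊕ ⋯ ⊕ Rʳ` with `Rʳ ≠ 0`, the element `L ∈ R¹` has the strong
Lefschetz property at degree `l` (where `2 l ≤ r`): multiplication by `L ^ (r - 2 l)` is a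
bijection from `Rˡ` onto `Rʳ⁻ˡ`. -/
structure StrongLefschetzAt {A : Type*} [CommRing A] [Algebra ℝ A]
    (R : ℕ → Submodule ℝ A) (r l : ℕ) (L : A) : Prop where
  top_ne_bot : R r ≠ ⊥
  eq_bot_of_lt : ∀ i, r < i → R i = ⊥
  two_mul_le : 2 * l ≤ r
  mem_one : L ∈ R 1
  bijOn : Set.BijOn (fun ξ : A => L ^ (r - 2 * l) * ξ) (R l) (R (r - l))

/-- The set `T` of edges of `G` is the edge set of a spanning tree of `G`. -/
def IsSpanningTree {V : Type*} (G : SimpleGraph V) (T : Finset G.edgeSet) : Prop :=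
  (SimpleGraph.fromEdgeSet ((fun e : G.edgeSet => (e : Sym2 V)) '' (T : Set G.edgeSet))).IsTree

open Classical in
/-- The Kirchhoff polynomial of `G`, with one variable for each edge:
the sum of `∏ e ∈ T, x_e` over the spanning trees `T` of `G`. -/
noncomputable def kirchhoffPolynomial {V : Type*} (G : SimpleGraph V) [Fintype G.edgeSet] :
    MvPolynomial G.edgeSet ℝ :=
  ∑ T : Finset G.edgeSet with IsSpanningTree G T, ∏ e ∈ T, X e

end GraphLefschetz

/-!
Let `F` be homogeneous of degree `r ≥ 2` with `F(a) ≠ 0`. For linear forms `L_η` and `L_ξ` the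
constant `L_η(∂) L_a(∂)^(r-2) L_ξ(∂) F` is `(r - 2)!` times the Hessian form of `F` at `a` evaluated
at `(η, ξ)`, so the strong Lefschetz property of `L_a` in degree one follows from the
nondegeneracy of this Hessian.

By the matrix-tree theorem the Kirchhoff polynomial is the determinant of the reduced weighted
Laplacian `L(x) = ∑ xₑ wₑ wₑᵀ`, where `wₑ` are the rows of the reduced incidence matrix. Its Hessian
form at `a` is
`det L(a) * (tr(L(a)⁻¹ L(η)) tr(L(a)⁻¹ L(ξ)) - tr(L(a)⁻¹ L(η) L(a)⁻¹ L(ξ)))`. If `ξ` is in the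
kernel, taking `η = a` gives `(r - 1) tr(L(a)⁻¹ L(ξ)) = 0`, and then taking `η = ξ` gives
`tr((L(a)⁻¹ L(ξ))²) = 0`, which forces `L(ξ) = 0` because `L(a)` is positive definite. As the
matrices `wₑ wₑᵀ` are linearly independent, `ξ = 0`.
-/

namespace GraphLefschetz

open MvPolynomial Matrix

section HomogeneousPolynomials

variable {σ R : Type*} [CommRing R]

theorem homogeneous_succ_induction {k : ℕ} {p : MvPolynomial σ R → Prop} (zero : p 0)
    (add : ∀ P Q, p P → p Q → p (P + Q))
    (mul_X : ∀ (P : MvPolynomial σ R) (i : σ), P.IsHomogeneous k → p (P * X i))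
    {P : MvPolynomial σ R} (hP : P.IsHomogeneous (k + 1)) : p P := by
  rw [← mem_homogeneousSubmodule, ← homogeneousSubmodule_one_pow, pow_succ,
    homogeneousSubmodule_one_pow] at hP
  refine Submodule.mul_induction_on hP (fun Q hQ L hL => ?_) add
  rw [homogeneousSubmodule_one_eq_span_X] at hL
  induction hL using Submodule.span_induction generalizing Q with
  | zero => rwa [mul_zero]
  | mem L hL =>
    obtain ⟨i, rfl⟩ := hL
    exact mul_X Q i hQ
  | add L L' _ _ ihL ihL' =>
    rw [mul_add]
    exact add _ _ (ihL Q hQ) (ihL' Q hQ)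
  | smul c L _ ihL =>
    rw [mul_smul_comm, ← smul_mul_assoc]
    exact ihL (c • Q) (Submodule.smul_mem _ c hQ)

theorem isHomogeneous_zero_iff_eq_C {P : MvPolynomial σ R} :
    P.IsHomogeneous 0 ↔ P = C (coeff 0 P) :=
  (totalDegree_zero_iff_isHomogeneous _).symm.trans totalDegree_eq_zero_iff_eq_C

theorem pderiv_eq_zero_of_isHomogeneous_zero {F : MvPolynomial σ R} (hF : F.IsHomogeneous 0)
    (i : σ) : pderiv i F = 0 := by
  rw [isHomogeneous_zero_iff_eq_C.mp hF, pderiv_C]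

theorem isHomogeneous_det {m : Type*} [Fintype m] [DecidableEq m] {d : ℕ}
    {M : Matrix m m (MvPolynomial σ R)} (hM : ∀ i j, (M i j).IsHomogeneous d) :
    M.det.IsHomogeneous (Fintype.card m * d) := by
  rw [det_apply]
  refine IsHomogeneous.sum _ _ _ fun τ _ => ?_
  have hprod : (∏ i, M (τ i) i).IsHomogeneous (Fintype.card m * d) := by
    simpa using IsHomogeneous.prod Finset.univ _ (fun _ => d) fun i _ => hM (τ i) i
  rcases Int.units_eq_one_or (Equiv.Perm.sign τ) with h | h
  · rwa [h, one_smul]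
  · rw [h, Units.neg_smul, one_smul]
    exact hprod.neg

theorem eq_zero_of_pderiv_eq_zero [Finite σ] [IsDomain R] [CharZero R] {F : MvPolynomial σ R}
    {d : ℕ} (hd : d ≠ 0) (hF : F.IsHomogeneous d) (h : ∀ i, pderiv i F = 0) : F = 0 := by
  have := Fintype.ofFinite σ
  have euler : d • F = 0 := by simp [← hF.sum_X_mul_pderiv, h]
  exact (smul_eq_zero.mp euler).resolve_left hd

/-- The Hessian matrix of `F` at the point `a`. -/
noncomputable def hessian (F : MvPolynomial σ R) (a : σ → R) : Matrix σ σ R :=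
  Matrix.of fun i j => eval a (pderiv i (pderiv j F))

variable [Fintype σ]

/-- The linear form `∑ aᵢ xᵢ`. -/
noncomputable def linearForm (a : σ → R) : MvPolynomial σ R :=
  ∑ i, C (a i) * X i

theorem isHomogeneous_linearForm (a : σ → R) : (linearForm a).IsHomogeneous 1 :=
  IsHomogeneous.sum _ _ _ fun i _ => isHomogeneous_C_mul_X (a i) i

theorem isHomogeneous_one_iff_exists_linearForm {P : MvPolynomial σ R} :
    P.IsHomogeneous 1 ↔ ∃ a, linearForm a = P := by
  rw [← mem_homogeneousSubmodule, homogeneousSubmodule_one_eq_span_X,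
    Submodule.mem_span_range_iff_exists_fun]
  simp only [linearForm, smul_eq_C_mul]

theorem isHomogeneous_linearForm_pow_mul {k : ℕ} (a : σ → R) (s : ℕ) {P : MvPolynomial σ R}
    (hP : P.IsHomogeneous k) : (linearForm a ^ s * P).IsHomogeneous (s + k) := by
  simpa only [one_mul] using ((isHomogeneous_linearForm a).pow s).mul hP

end HomogeneousPolynomials

section DifferentialOperators

variable {σ : Type*}

theorem diffOp_C (c : ℝ) (F : MvPolynomial σ ℝ) : diffOp σ (C c) F = C c * F := by
  rw [← algebraMap_eq, AlgHom.commutes, Module.algebraMap_end_apply, algebraMap_eq, smul_eq_C_mul]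

theorem diffOp_mul (P Q F : MvPolynomial σ ℝ) :
    diffOp σ (P * Q) F = diffOp σ P (diffOp σ Q F) := by
  rw [map_mul, Module.End.mul_apply]

theorem isHomogeneous_diffOp {k d : ℕ} {P F : MvPolynomial σ ℝ} (hP : P.IsHomogeneous k)
    (hF : F.IsHomogeneous d) : (diffOp σ P F).IsHomogeneous (d - k) := by
  induction k generalizing P d F with
  | zero =>
    rw [isHomogeneous_zero_iff_eq_C.mp hP, diffOp_C]
    exact hF.C_mul _
  | succ k ih =>
    refine homogeneous_succ_induction (p := fun P => (diffOp σ P F).IsHomogeneous (d - (k + 1)))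
      ?_ (fun P Q hP hQ => ?_) (fun P i hP => ?_) hP
    · simpa using isHomogeneous_zero σ ℝ (d - (k + 1))
    · simpa using hP.add hQ
    · rw [diffOp_mul, diffOp_X, add_comm k 1, ← Nat.sub_sub]
      exact ih hP hF.pderiv

theorem diffOp_eq_zero_of_lt {k d : ℕ} {P F : MvPolynomial σ ℝ} (hP : P.IsHomogeneous k)
    (hF : F.IsHomogeneous d) (hdk : d < k) : diffOp σ P F = 0 := by
  induction k generalizing P d F with
  | zero => exact absurd hdk d.not_lt_zero
  | succ k ih =>
    refine homogeneous_succ_induction (p := fun P => diffOp σ P F = 0)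
      ?_ (fun P Q hP hQ => ?_) (fun P i hP => ?_) hP
    · rw [map_zero, LinearMap.zero_apply]
    · rw [map_add, LinearMap.add_apply, hP, hQ, add_zero]
    · rw [diffOp_mul, diffOp_X]
      rcases d.eq_zero_or_pos with rfl | hd
      · rw [pderiv_eq_zero_of_isHomogeneous_zero hF, map_zero]
      · exact ih hP hF.pderiv (by omega)

variable [Fintype σ]

theorem diffOp_linearForm (a : σ → ℝ) (F : MvPolynomial σ ℝ) :
    diffOp σ (linearForm a) F = ∑ i, C (a i) * pderiv i F := by
  rw [linearForm, map_sum, LinearMap.sum_apply]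
  simp only [diffOp_mul, diffOp_X, diffOp_C]

theorem diffOp_linearForm_pow (a : σ → ℝ) {d : ℕ} {F : MvPolynomial σ ℝ}
    (hF : F.IsHomogeneous d) :
    diffOp σ (linearForm a ^ d) F = C (d.factorial * eval a F) := by
  induction d generalizing F with
  | zero =>
    rw [isHomogeneous_zero_iff_eq_C.mp hF]
    simp
  | succ d ih =>
    have hdF : (diffOp σ (linearForm a) F).IsHomogeneous d :=
      isHomogeneous_diffOp (isHomogeneous_linearForm a) hF
    have euler : eval a (diffOp σ (linearForm a) F) = (d + 1 : ℕ) * eval a F := by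
      have h := congrArg (eval a) hF.sum_X_mul_pderiv
      simpa [diffOp_linearForm] using h
    rw [pow_succ, diffOp_mul, ih hdF, euler, Nat.factorial_succ]
    push_cast
    ring_nf

theorem diffOp_X_mul_linearForm_pow_mul_linearForm (a ξ : σ → ℝ) {s : ℕ} {F : MvPolynomial σ ℝ}
    (hF : F.IsHomogeneous (s + 2)) (i : σ) :
    diffOp σ (X i * (linearForm a ^ s * linearForm ξ)) F =
      C (s.factorial * (hessian F a *ᵥ ξ) i) := by
  have hξF : (diffOp σ (X i * linearForm ξ) F).IsHomogeneous s :=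
    isHomogeneous_diffOp ((isHomogeneous_X ℝ i).mul (isHomogeneous_linearForm ξ)) hF
  have heval : eval a (diffOp σ (X i * linearForm ξ) F) = (hessian F a *ᵥ ξ) i := by
    simp [diffOp_X, diffOp_linearForm, pderiv_comm i, hessian, mulVec, dotProduct, mul_comm]
  rw [mul_left_comm, diffOp_mul, diffOp_linearForm_pow a hξF, heval]

end DifferentialOperators

section HessianCriterion

variable {σ : Type*} {F : MvPolynomial σ ℝ} {r s : ℕ}

theorem mk_eq_zero_iff {P : MvPolynomial σ ℝ} :
    Ideal.Quotient.mk (annIdeal F) P = 0 ↔ diffOp σ P F = 0 :=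
  Ideal.Quotient.eq_zero_iff_mem

theorem mem_gradedPiece_iff {l : ℕ} {x : GorensteinAlgebra F} :
    x ∈ gradedPiece F l ↔ ∃ P : MvPolynomial σ ℝ, P.IsHomogeneous l ∧
      Ideal.Quotient.mk (annIdeal F) P = x :=
  Iff.rfl

theorem gradedPiece_eq_bot_of_lt (hF : F.IsHomogeneous r) {l : ℕ} (hl : r < l) :
    gradedPiece F l = ⊥ := by
  refine (Submodule.eq_bot_iff _).mpr fun x hx => ?_
  obtain ⟨P, hP, rfl⟩ := mem_gradedPiece_iff.mp hx
  exact mk_eq_zero_iff.mpr (diffOp_eq_zero_of_lt hP hF hl)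

theorem gradedPiece_ne_bot [Finite σ] {a : σ → ℝ} (hF : F.IsHomogeneous r) (hFa : eval a F ≠ 0) :
    gradedPiece F r ≠ ⊥ := by
  have := Fintype.ofFinite σ
  refine (Submodule.ne_bot_iff _).mpr ⟨Ideal.Quotient.mk (annIdeal F) (linearForm a ^ r), ?_, ?_⟩
  · exact mem_gradedPiece_iff.mpr
      ⟨_, by simpa only [one_mul] using (isHomogeneous_linearForm a).pow r, rfl⟩
  · rw [Ne, mk_eq_zero_iff, diffOp_linearForm_pow a hF, C_eq_zero]
    exact mul_ne_zero (Nat.cast_ne_zero.mpr r.factorial_ne_zero) hFa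

variable [Fintype σ] {a : σ → ℝ}

theorem linearElement_mem_gradedPiece_one (F : MvPolynomial σ ℝ) (a : σ → ℝ) :
    linearElement F a ∈ gradedPiece F 1 :=
  mem_gradedPiece_iff.mpr ⟨linearForm a, isHomogeneous_linearForm a, rfl⟩

theorem linearElement_pow_mul_mk (F : MvPolynomial σ ℝ) (a : σ → ℝ) (s : ℕ)
    (P : MvPolynomial σ ℝ) :
    linearElement F a ^ s * Ideal.Quotient.mk (annIdeal F) P =
      Ideal.Quotient.mk (annIdeal F) (linearForm a ^ s * P) := by
  rw [map_mul, map_pow]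
  rfl

variable [DecidableEq σ]

theorem injOn_linearElement_pow_mul (hF : F.IsHomogeneous (s + 2)) (hH : (hessian F a).det ≠ 0) :
    Set.InjOn (linearElement F a ^ s * ·) (gradedPiece F 1) := by
  refine LinearMap.injOn_of_disjoint_ker (f := LinearMap.mulLeft ℝ (linearElement F a ^ s))
    le_rfl (Submodule.disjoint_def.mpr fun x hx hker => ?_)
  obtain ⟨P, hP, rfl⟩ := mem_gradedPiece_iff.mp hx
  obtain ⟨ξ, rfl⟩ := isHomogeneous_one_iff_exists_linearForm.mp hP
  rw [LinearMap.mem_ker, LinearMap.mulLeft_apply, linearElement_pow_mul_mk, mk_eq_zero_iff] at hker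
  have hHξ : hessian F a *ᵥ ξ = 0 := by
    funext i
    have h := diffOp_X_mul_linearForm_pow_mul_linearForm a ξ hF i
    rw [diffOp_mul, hker, map_zero, eq_comm, C_eq_zero] at h
    exact (mul_eq_zero.mp h).resolve_left (Nat.cast_ne_zero.mpr s.factorial_ne_zero)
  rw [eq_zero_of_mulVec_eq_zero hH hHξ]
  simp [linearForm]

theorem surjOn_linearElement_pow_mul (hF : F.IsHomogeneous (s + 2)) (hH : (hessian F a).det ≠ 0) :
    Set.SurjOn (linearElement F a ^ s * ·) (gradedPiece F 1) (gradedPiece F (s + 1)) := by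
  intro x hx
  obtain ⟨P, hP, rfl⟩ := mem_gradedPiece_iff.mp hx
  have hconst : ∀ i, diffOp σ (X i * P) F = C (coeff 0 (diffOp σ (X i * P) F)) := fun i => by
    have h := isHomogeneous_diffOp ((isHomogeneous_X ℝ i).mul hP) hF
    rw [show s + 2 - (1 + (s + 1)) = 0 by omega] at h
    exact isHomogeneous_zero_iff_eq_C.mp h
  obtain ⟨ξ, hξ⟩ : ∃ ξ, hessian F a *ᵥ ξ =
      fun i => (s.factorial : ℝ)⁻¹ * coeff 0 (diffOp σ (X i * P) F) :=
    mulVec_surjective_iff_isUnit.mpr ((isUnit_iff_isUnit_det _).mpr hH.isUnit) _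
  refine ⟨Ideal.Quotient.mk (annIdeal F) (linearForm ξ),
    mem_gradedPiece_iff.mpr ⟨_, isHomogeneous_linearForm ξ, rfl⟩, ?_⟩
  change linearElement F a ^ s * _ = _
  rw [linearElement_pow_mul_mk, ← sub_eq_zero, ← map_sub, mk_eq_zero_iff]
  have hQ : (linearForm a ^ s * linearForm ξ - P).IsHomogeneous (s + 1) :=
    (isHomogeneous_linearForm_pow_mul a s (isHomogeneous_linearForm ξ)).sub hP
  refine eq_zero_of_pderiv_eq_zero (by omega) (isHomogeneous_diffOp hQ hF) fun i => ?_
  rw [← diffOp_X, ← diffOp_mul, mul_sub, map_sub, LinearMap.sub_apply,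
    diffOp_X_mul_linearForm_pow_mul_linearForm a ξ hF, hconst, hξ,
    mul_inv_cancel_left₀ (Nat.cast_ne_zero.mpr s.factorial_ne_zero), sub_self]

theorem strongLefschetzAt_one_of_det_hessian_ne_zero (hr : 2 ≤ r) (hF : F.IsHomogeneous r)
    (hFa : eval a F ≠ 0) (hH : (hessian F a).det ≠ 0) :
    StrongLefschetzAt (gradedPiece F) r 1 (linearElement F a) where
  top_ne_bot := gradedPiece_ne_bot hF hFa
  eq_bot_of_lt _ := gradedPiece_eq_bot_of_lt hF
  two_mul_le := hr
  mem_one := linearElement_mem_gradedPiece_one F a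
  bijOn := by
    obtain ⟨s, rfl⟩ := Nat.exists_eq_add_of_le' hr
    refine ⟨fun x hx => ?_, injOn_linearElement_pow_mul hF hH, surjOn_linearElement_pow_mul hF hH⟩
    obtain ⟨P, hP, rfl⟩ := mem_gradedPiece_iff.mp hx
    exact mem_gradedPiece_iff.mpr ⟨_, isHomogeneous_linearForm_pow_mul a s hP,
      (linearElement_pow_mul_mk F a s P).symm⟩

end HessianCriterion

section CoordinateDerivatives

variable {σ 𝕜 : Type*} [DecidableEq σ] [NontriviallyNormedField 𝕜]

theorem hasDerivAt_eval_add_single (p : MvPolynomial σ 𝕜) (x : σ → 𝕜) (i : σ) (t : 𝕜) :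
    HasDerivAt (fun s => eval (x + Pi.single i s) p)
      (eval (x + Pi.single i t) (pderiv i p)) t := by
  induction p using MvPolynomial.induction_on with
  | C c => simpa using hasDerivAt_const t c
  | add p q hp hq => simpa using hp.fun_add hq
  | mul_X p j hp =>
    rcases eq_or_ne i j with rfl | hij
    · have hX : HasDerivAt (fun s => x i + s) 1 t := (hasDerivAt_id t).const_add (x i)
      simpa [add_comm, mul_comm] using hp.fun_mul hX
    · simpa [hij, hij.symm, mul_comm] using hp.mul_const (x j)

theorem eval_pderiv_pderiv_eq {p : MvPolynomial σ 𝕜} {x : σ → 𝕜} {i j : σ} {α β γ δ : 𝕜}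
    (h : ∀ s t, eval (x + Pi.single i s + Pi.single j t) p = α + β * s + γ * t + δ * (s * t)) :
    eval x (pderiv i (pderiv j p)) = δ := by
  have hj : ∀ s, eval (x + Pi.single i s) (pderiv j p) = γ + δ * s := fun s => by
    have hp := hasDerivAt_eval_add_single p (x + Pi.single i s) j 0
    simp only [h, Pi.single_zero, add_zero] at hp
    refine hp.unique ?_
    simpa using (((hasDerivAt_id (0 : 𝕜)).const_mul γ).const_add (α + β * s)).fun_add
      (((hasDerivAt_id (0 : 𝕜)).const_mul s).const_mul δ)
  have hi := hasDerivAt_eval_add_single (pderiv j p) x i 0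
  simp only [hj, Pi.single_zero, add_zero] at hi
  exact hi.unique (by simpa using ((hasDerivAt_id (0 : 𝕜)).const_mul δ).const_add γ)

end CoordinateDerivatives

section WeightedGram

variable {E m R S : Type*} [Fintype E]

section CommRing

variable [CommRing R] [CommRing S]

/-- The Gram matrix `∑ xₑ wₑ wₑᵀ` of the rows `wₑ` of `W`, weighted by `x`. If `W` is an incidence
matrix of a graph, it is the weighted Laplacian. -/
def weightedGram (W : Matrix E m R) (x : E → R) : Matrix m m R :=
  ∑ e, x e • vecMulVec (W e) (W e)

theorem weightedGram_apply (W : Matrix E m R) (x : E → R) (i j : m) :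
    weightedGram W x i j = ∑ e, x e * (W e i * W e j) := by
  simp [weightedGram, Matrix.sum_apply, vecMulVec_apply]

theorem weightedGram_eq_transpose_mul_diagonal_mul [DecidableEq E] (W : Matrix E m R)
    (x : E → R) : weightedGram W x = Wᵀ * diagonal x * W := by
  ext i j
  rw [weightedGram_apply, mul_apply]
  exact Finset.sum_congr rfl fun e _ => by rw [mul_diagonal, transpose_apply]; ring

theorem transpose_weightedGram (W : Matrix E m R) (x : E → R) :
    (weightedGram W x)ᵀ = weightedGram W x := by
  ext i j
  simp only [transpose_apply, weightedGram_apply, mul_comm (W _ j)]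

theorem weightedGram_add (W : Matrix E m R) (x y : E → R) :
    weightedGram W (x + y) = weightedGram W x + weightedGram W y := by
  simp only [weightedGram, Pi.add_apply, add_smul, Finset.sum_add_distrib]

theorem weightedGram_map (f : R →+* S) (W : Matrix E m R) (x : E → R) :
    weightedGram (W.map f) (f ∘ x) = (weightedGram W x).map f := by
  ext i j
  simp [weightedGram_apply]

theorem weightedGram_single_add_single [DecidableEq E] (W : Matrix E m R) (i j : E) (s t : R) :
    weightedGram W (Pi.single i s + Pi.single j t) =
      weightedGram (W.submatrix ![i, j] id) ![s, t] := by
  ext k l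
  simp only [weightedGram_apply, Fin.sum_univ_two]
  simp [add_mul, Finset.sum_add_distrib, Pi.single_apply]

variable [Fintype m] [DecidableEq m]

/-- The polynomial `det (∑ xₑ wₑ wₑᵀ)` in the weights of the rows `wₑ` of `W`. For the reduced
incidence matrix of a graph, it is the Kirchhoff polynomial. -/
noncomputable def gramPolynomial (W : Matrix E m R) : MvPolynomial E R :=
  (weightedGram (W.map C) X).det

theorem eval_gramPolynomial (W : Matrix E m R) (x : E → R) :
    eval x (gramPolynomial W) = (weightedGram W x).det := by
  rw [gramPolynomial, RingHom.map_det, RingHom.mapMatrix_apply, ← weightedGram_map]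
  congr 2 <;> ext <;> simp

theorem isHomogeneous_gramPolynomial (W : Matrix E m R) :
    (gramPolynomial W).IsHomogeneous (Fintype.card m) := by
  rw [← mul_one (Fintype.card m)]
  refine isHomogeneous_det fun i j => ?_
  simp only [weightedGram_apply, map_apply, ← C_mul, mul_comm (X _)]
  exact IsHomogeneous.sum _ _ _ fun e _ => isHomogeneous_C_mul_X _ e

/-- The Gram matrix of the rows of `W` for the inverse of their weighted Gram matrix. Its
principal minors of order two give the Hessian of `gramPolynomial W`. -/
noncomputable def dualGram (W : Matrix E m R) (x : E → R) : Matrix E E R :=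
  W * (weightedGram W x)⁻¹ * Wᵀ

theorem det_weightedGram_add_single_add_single [DecidableEq E] (W : Matrix E m R) (x : E → R)
    (hx : IsUnit (weightedGram W x).det) (i j : E) (s t : R) :
    (weightedGram W (x + Pi.single i s + Pi.single j t)).det =
      (weightedGram W x).det * ((1 + s * dualGram W x i i) * (1 + t * dualGram W x j j) -
        s * t * (dualGram W x i j * dualGram W x j i)) := by
  let B := W.submatrix ![i, j] id
  have hentry : ∀ k l, (B * (weightedGram W x)⁻¹ * Bᵀ) k l =
      dualGram W x (![i, j] k) (![i, j] l) := fun _ _ => rfl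
  have hdet : (1 + diagonal ![s, t] * B * (weightedGram W x)⁻¹ * Bᵀ).det =
      (1 + s * dualGram W x i i) * (1 + t * dualGram W x j j) -
        s * t * (dualGram W x i j * dualGram W x j i) := by
    rw [Matrix.mul_assoc (diagonal _), Matrix.mul_assoc (diagonal _), det_fin_two]
    simp [Matrix.add_apply, diagonal_mul, hentry]
    ring
  rw [add_assoc, weightedGram_add, weightedGram_single_add_single,
    weightedGram_eq_transpose_mul_diagonal_mul (W.submatrix _ _), Matrix.mul_assoc,
    det_add_mul _ _ hx, hdet]

end CommRing

section Hessian

variable {𝕜 : Type*} [NontriviallyNormedField 𝕜]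

variable [Fintype m] [DecidableEq m]

theorem hessian_gramPolynomial_apply (W : Matrix E m 𝕜) {x : E → 𝕜}
    (hx : IsUnit (weightedGram W x).det) (i j : E) :
    hessian (gramPolynomial W) x i j = (weightedGram W x).det *
      (dualGram W x i i * dualGram W x j j - dualGram W x i j * dualGram W x j i) := by
  classical
  refine eval_pderiv_pderiv_eq (α := (weightedGram W x).det)
    (β := (weightedGram W x).det * dualGram W x i i)
    (γ := (weightedGram W x).det * dualGram W x j j) fun s t => ?_
  rw [eval_gramPolynomial, det_weightedGram_add_single_add_single W x hx]
  ring

theorem dotProduct_hessian_gramPolynomial_mulVec (W : Matrix E m 𝕜) {x : E → 𝕜}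
    (hx : IsUnit (weightedGram W x).det) (η ξ : E → 𝕜) :
    η ⬝ᵥ hessian (gramPolynomial W) x *ᵥ ξ = (weightedGram W x).det *
      (((weightedGram W x)⁻¹ * weightedGram W η).trace *
          ((weightedGram W x)⁻¹ * weightedGram W ξ).trace -
        ((weightedGram W x)⁻¹ * weightedGram W η *
          ((weightedGram W x)⁻¹ * weightedGram W ξ)).trace) := by
  classical
  generalize hA : (weightedGram W x)⁻¹ = A
  have hG : dualGram W x = W * A * Wᵀ := by rw [dualGram, hA]
  have htrace : ∀ ζ, (A * weightedGram W ζ).trace = ∑ e, ζ e * dualGram W x e e := fun ζ => by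
    rw [weightedGram_eq_transpose_mul_diagonal_mul, ← Matrix.mul_assoc, trace_mul_comm,
      ← Matrix.mul_assoc, ← Matrix.mul_assoc, trace_mul_comm, ← hG]
    simp [trace, diagonal_mul]
  have htrace₂ : (A * weightedGram W η * (A * weightedGram W ξ)).trace =
      (diagonal η * dualGram W x * (diagonal ξ * dualGram W x)).trace := by
    simp only [weightedGram_eq_transpose_mul_diagonal_mul, hG, Matrix.mul_assoc]
    rw [← Matrix.mul_assoc A, trace_mul_comm]
    simp only [Matrix.mul_assoc]
  rw [htrace, htrace, htrace₂, Finset.sum_mul_sum, trace]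
  simp only [dotProduct, mulVec, hessian_gramPolynomial_apply W hx, diag_apply,
    mul_apply (M := diagonal η * _), diagonal_mul, Finset.mul_sum, ← Finset.sum_sub_distrib]
  exact Finset.sum_congr rfl fun i _ => Finset.sum_congr rfl fun j _ => by ring

end Hessian

section PosDef

open scoped MatrixOrder ComplexOrder in
theorem eq_zero_of_posDef_of_trace_eq_zero {m 𝕜 : Type*} [Fintype m] [RCLike 𝕜]
    {A M : Matrix m m 𝕜} (hA : A.PosDef) (hM : M.IsHermitian) (h : (A * M * (A * M)).trace = 0) :
    M = 0 := by
  classical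
  obtain ⟨B, hB, rfl⟩ := CStarAlgebra.isStrictlyPositive_iff_eq_star_mul_self.mp
    hA.isStrictlyPositive
  have htrace : ((B * M * Bᴴ)ᴴ * (B * M * Bᴴ)).trace = 0 := by
    rw [← h, trace_mul_comm _ (star B * B * M)]
    simp only [conjTranspose_mul, conjTranspose_conjTranspose, hM.eq, star_eq_conjTranspose,
      ← Matrix.mul_assoc]
    rw [trace_mul_comm]
    simp only [← Matrix.mul_assoc]
  have hBMB : B * M * star B = 0 := trace_conjTranspose_mul_self_eq_zero_iff.mp htrace
  rwa [(hB.star).mul_left_eq_zero, hB.mul_right_eq_zero] at hBMB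

variable {W : Matrix E m ℝ} {a : E → ℝ} [Fintype m]

theorem posDef_weightedGram (hW : Function.Injective W.mulVec) (ha : ∀ e, 0 < a e) :
    (weightedGram W a).PosDef := by
  classical
  rw [weightedGram_eq_transpose_mul_diagonal_mul, ← conjTranspose_eq_transpose_of_trivial]
  exact (PosDef.diagonal ha).conjTranspose_mul_mul_same hW

variable [DecidableEq m]

theorem det_hessian_gramPolynomial_ne_zero [DecidableEq E] (hm : Fintype.card m ≠ 1)
    (hW : LinearIndependent ℝ fun e => vecMulVec (W e) (W e)) (ha : (weightedGram W a).PosDef) :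
    (hessian (gramPolynomial W) a).det ≠ 0 := by
  have hdet : IsUnit (weightedGram W a).det := ha.det_pos.ne'.isUnit
  intro h
  obtain ⟨ξ, hξ, hker⟩ := exists_mulVec_eq_zero_iff.mpr h
  refine hξ (funext (Fintype.linearIndependent_iff.mp hW ξ ?_))
  have htrace : ∀ η, ((weightedGram W a)⁻¹ * weightedGram W η).trace *
      ((weightedGram W a)⁻¹ * weightedGram W ξ).trace =
        ((weightedGram W a)⁻¹ * weightedGram W η *
          ((weightedGram W a)⁻¹ * weightedGram W ξ)).trace := fun η => by
    have h := dotProduct_hessian_gramPolynomial_mulVec W hdet η ξ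
    rw [hker, dotProduct_zero, eq_comm] at h
    exact sub_eq_zero.mp ((mul_eq_zero.mp h).resolve_left hdet.ne_zero)
  have htrace_zero : ((weightedGram W a)⁻¹ * weightedGram W ξ).trace = 0 := by
    have h := htrace a
    rw [nonsing_inv_mul _ hdet, trace_one, Matrix.one_mul, mul_left_eq_self₀] at h
    exact h.resolve_left (mod_cast hm)
  have h := htrace ξ
  rw [htrace_zero, mul_zero, eq_comm] at h
  exact eq_zero_of_posDef_of_trace_eq_zero ha.inv (transpose_weightedGram W ξ) h

theorem strongLefschetzAt_one_gramPolynomial (hm : 2 ≤ Fintype.card m)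
    (hW : LinearIndependent ℝ fun e => vecMulVec (W e) (W e)) (ha : (weightedGram W a).PosDef) :
    StrongLefschetzAt (gradedPiece (gramPolynomial W)) (Fintype.card m) 1
      (linearElement (gramPolynomial W) a) := by
  classical
  refine strongLefschetzAt_one_of_det_hessian_ne_zero hm (isHomogeneous_gramPolynomial W) ?_
    (det_hessian_gramPolynomial_ne_zero (by omega) hW ha)
  rw [eval_gramPolynomial]
  exact ha.det_pos.ne'

end PosDef

end WeightedGram

section CauchyBinet

theorem map_univ_eq_iff_forall_mem {E m : Type*} [Fintype m] {S : Finset E}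
    (hS : S.card = Fintype.card m) (f : m ↪ E) : Finset.univ.map f = S ↔ ∀ i, f i ∈ S := by
  refine ⟨fun h i => h ▸ Finset.mem_map_of_mem f (Finset.mem_univ i), fun h => ?_⟩
  refine Finset.eq_of_subset_of_card_le (fun e he => ?_) (by simp [hS])
  obtain ⟨i, -, rfl⟩ := Finset.mem_map.mp he
  exact h i

variable {E m R : Type*} [Fintype E] [Fintype m] [DecidableEq m] [CommRing R]

theorem det_weightedGram_eq_sum_fun (W : Matrix E m R) (x : E → R) :
    (weightedGram W x).det =
      ∑ f : m → E, (∏ i, x (f i)) * ((∏ i, W (f i) i) * (W.submatrix f id).det) := by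
  have hrow : weightedGram W x = fun i => ∑ e, (x e * W e i) • W e := by
    ext i j
    simp [weightedGram_apply, mul_assoc]
  rw [hrow]
  refine (detRowAlternating.toMultilinearMap.map_sum _).trans (Finset.sum_congr rfl fun f _ => ?_)
  rw [MultilinearMap.map_smul_univ, Finset.prod_mul_distrib, smul_eq_mul, mul_assoc]
  rfl

theorem det_weightedGram_eq_sum_embedding (W : Matrix E m R) (x : E → R) :
    (weightedGram W x).det =
      ∑ f : m ↪ E, (∏ i, x (f i)) * ((∏ i, W (f i) i) * (W.submatrix f id).det) := by
  rw [det_weightedGram_eq_sum_fun, eq_comm]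
  refine Finset.sum_of_injOn (fun f => (f : m → E)) DFunLike.coe_injective.injOn (by simp)
    (fun f _ hf => ?_) fun _ _ => rfl
  obtain ⟨i, j, hij, hne⟩ : ∃ i j, f i = f j ∧ i ≠ j := by
    by_contra! h
    exact hf ⟨⟨f, h⟩, by simp, rfl⟩
  rw [det_zero_of_row_eq hne (by ext; simp [hij]), mul_zero, mul_zero]

theorem det_weightedGram (W : Matrix E m R) (x : E → R) :
    (weightedGram W x).det = ∑ S ∈ Finset.powersetCard (Fintype.card m) Finset.univ,
      (∏ e ∈ S, x e) * (weightedGram (W.submatrix ((↑) : S → E) id) 1).det := by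
  classical
  have hmaps : ∀ f ∈ (Finset.univ : Finset (m ↪ E)),
      Finset.univ.map f ∈ Finset.powersetCard (Fintype.card m) (Finset.univ : Finset E) := by
    simp [Finset.mem_powersetCard]
  rw [det_weightedGram_eq_sum_embedding, ← Finset.sum_fiberwise_of_maps_to hmaps]
  refine Finset.sum_congr rfl fun S hS => ?_
  rw [det_weightedGram_eq_sum_embedding, Finset.mul_sum]
  have hiff := map_univ_eq_iff_forall_mem (m := m) (Finset.mem_powersetCard.mp hS).2
  refine Finset.sum_bij'
    (fun f hf => f.codRestrict S ((hiff f).mp (Finset.mem_filter.mp hf).2))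
    (fun g _ => g.trans (.subtype _)) (by simp) (by simp [hiff])
    (fun _ _ => rfl) (fun _ _ => rfl) (fun f hf => ?_)
  have hprod : ∏ e ∈ S, x e = ∏ i, x (f i) := by
    rw [← (Finset.mem_filter.mp hf).2, Finset.prod_map]
  simp only [hprod, Pi.one_apply, Finset.prod_const_one, one_mul]
  rfl

end CauchyBinet

section SquareMatrices

variable {E m R : Type*} [Fintype m] [CommRing R]

theorem eq_zero_of_sum_row_eq_zero {L : Matrix m m R} (hL : Lᵀ = L)
    (hsum : ∀ u, ∑ w, L u w = 0) {v₀ : m} (h : ∀ u w, u ≠ v₀ → w ≠ v₀ → L u w = 0) : L = 0 := by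
  have hrow : ∀ u, (∀ w, w ≠ v₀ → L u w = 0) → ∀ w, L u w = 0 := fun u hu w => by
    obtain rfl | hw := eq_or_ne w v₀
    · rw [← hsum u, Finset.sum_eq_single w (fun w' _ => hu w') (by simp)]
    · exact hu w hw
  have hcol : ∀ w, w ≠ v₀ → L v₀ w = 0 := fun w hw => by
    rw [← hL, transpose_apply, hrow w fun w' hw' => h w w' hw hw']
  ext u w
  obtain rfl | hu := eq_or_ne u v₀
  · exact hrow u hcol w
  · exact hrow u (fun w' hw' => h u w' hu hw') w

variable [DecidableEq m]

theorem det_weightedGram_one_eq_sq [Fintype E] (W : Matrix E m R) (φ : m ≃ E) :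
    (weightedGram W 1).det = (W.submatrix φ id).det ^ 2 := by
  classical
  have hφ : Wᵀ * W = (W.submatrix φ id)ᵀ * W.submatrix φ id := by
    rw [transpose_submatrix, submatrix_mul_equiv, submatrix_id_id]
  rw [weightedGram_eq_transpose_mul_diagonal_mul, Pi.one_def, diagonal_one, Matrix.mul_one, hφ,
    det_mul, det_transpose, sq]

theorem det_submatrix_equiv_ne_zero_iff [IsDomain R] {W : Matrix E m R} (φ : m ≃ E) :
    (W.submatrix φ id).det ≠ 0 ↔ ∀ g, W *ᵥ g = 0 → g = 0 := by
  have hφ : ∀ g, W.submatrix φ id *ᵥ g = 0 ↔ W *ᵥ g = 0 := fun g => by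
    rw [← (φ.surjective.injective_comp_right).eq_iff]
    rfl
  rw [Ne, ← exists_mulVec_eq_zero_iff]
  simp only [hφ]
  grind

end SquareMatrices

section Incidence

variable {V : Type*} [DecidableEq V] (G : SimpleGraph V) (R : Type*) [CommRing R]

/-- The oriented incidence matrix of `G`, for an arbitrary orientation of its edges. -/
noncomputable def signedIncidence : Matrix G.edgeSet V R := fun e =>
  Pi.single (Quot.out (e : Sym2 V)).1 1 - Pi.single (Quot.out (e : Sym2 V)).2 1

/-- The oriented incidence matrix of `G` without the column of the vertex `v₀`. -/
noncomputable def reducedIncidence (v₀ : V) : Matrix G.edgeSet {v : V // v ≠ v₀} R :=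
  (signedIncidence G R).submatrix id Subtype.val

variable {G R}

theorem exists_signedIncidence_eq (R : Type*) [CommRing R] (e : G.edgeSet) :
    ∃ u w, G.Adj u w ∧ (e : Sym2 V) = s(u, w) ∧
      signedIncidence G R e = Pi.single u 1 - Pi.single w 1 := by
  have he : s((Quot.out (e : Sym2 V)).1, (Quot.out (e : Sym2 V)).2) = e := Quot.out_eq (e : Sym2 V)
  exact ⟨_, _, by rw [← SimpleGraph.mem_edgeSet, he]; exact e.2, he.symm, rfl⟩

theorem signedIncidence_eq_zero_of_notMem {e : G.edgeSet} {v : V} (h : v ∉ (e : Sym2 V)) :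
    signedIncidence G R e v = 0 := by
  obtain ⟨u, w, -, he, hrow⟩ := exists_signedIncidence_eq R e
  rw [he, Sym2.mem_iff, not_or] at h
  simp [hrow, h.1, h.2]

theorem reducedIncidence_map {S : Type*} [CommRing S] (f : R →+* S) (v₀ : V) :
    (reducedIncidence G R v₀).map f = reducedIncidence G S v₀ := by
  ext e v
  simp [reducedIncidence, signedIncidence, Pi.single_apply, apply_ite f]

theorem weightedGram_signedIncidence_apply_of_edge [Fintype G.edgeSet] {e : G.edgeSet}
    {u w : V} (huw : u ≠ w) (he : (e : Sym2 V) = s(u, w))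
    (ξ : G.edgeSet → R) : weightedGram (signedIncidence G R) ξ u w = -ξ e := by
  rw [weightedGram_apply, Finset.sum_eq_single e (fun f _ hf => ?_) (by simp)]
  · obtain ⟨u', w', -, he', hrow⟩ := exists_signedIncidence_eq R e
    rcases Sym2.eq_iff.mp (he'.symm.trans he) with ⟨rfl, rfl⟩ | ⟨rfl, rfl⟩ <;>
      simp [hrow, huw, huw.symm]
  · have hmem : ¬(u ∈ (f : Sym2 V) ∧ w ∈ (f : Sym2 V)) := by
      rw [Sym2.mem_and_mem_iff huw, ← he]
      exact fun h => hf (Subtype.ext h)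
    rcases not_and_or.mp hmem with h | h <;> simp [signedIncidence_eq_zero_of_notMem h]

theorem sum_weightedGram_signedIncidence [Fintype V] [Fintype G.edgeSet] (ξ : G.edgeSet → R)
    (u : V) :
    ∑ w, weightedGram (signedIncidence G R) ξ u w = 0 := by
  have hrow : ∀ e, ∑ w, signedIncidence G R e w = 0 := by simp [signedIncidence]
  simp only [weightedGram_apply]
  rw [Finset.sum_comm]
  simp only [← Finset.mul_sum, hrow, mul_zero, Finset.sum_const_zero]

theorem linearIndependent_vecMulVec_reducedIncidence [Finite V] (v₀ : V) :
    LinearIndependent R fun e =>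
      vecMulVec (reducedIncidence G R v₀ e) (reducedIncidence G R v₀ e) := by
  have := Fintype.ofFinite V
  have := Fintype.ofFinite G.edgeSet
  refine Fintype.linearIndependent_iff.mpr fun ξ hξ e => ?_
  have hred : ∀ u w, u ≠ v₀ → w ≠ v₀ → weightedGram (signedIncidence G R) ξ u w = 0 :=
    fun u w hu hw => by
      have h : weightedGram (reducedIncidence G R v₀) ξ ⟨u, hu⟩ ⟨w, hw⟩ = 0 := by
        rw [weightedGram, hξ, Matrix.zero_apply]
      rwa [weightedGram_apply] at h ⊢
  have hzero : weightedGram (signedIncidence G R) ξ = 0 :=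
    eq_zero_of_sum_row_eq_zero (transpose_weightedGram _ ξ)
      (sum_weightedGram_signedIncidence ξ) hred
  obtain ⟨u, w, huw, he, -⟩ := exists_signedIncidence_eq R e
  rw [← neg_eq_zero, ← weightedGram_signedIncidence_apply_of_edge huw.ne he, hzero,
    Matrix.zero_apply]

end Incidence

section Connectivity

theorem connected_iff_forall_eq_zero {V : Type*} (H : SimpleGraph V) (v₀ : V) (R : Type*)
    [Zero R] [One R] [NeZero (1 : R)] :
    H.Connected ↔ ∀ f : V → R, f v₀ = 0 → (∀ u w, H.Adj u w → f u = f w) → f = 0 := by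
  classical
  have hreach : ∀ (f : V → R) (_ : ∀ u w, H.Adj u w → f u = f w) u w, H.Reachable u w →
      f u = f w := by
    rintro f hf u w ⟨p⟩
    induction p with
    | nil => rfl
    | cons h _ ih => exact (hf _ _ h).trans ih
  refine ⟨fun hH f hf₀ hf => funext fun v => (hreach f hf v v₀ (hH v v₀)).trans hf₀, fun h => ?_⟩
  have : Nonempty V := ⟨v₀⟩
  have hind := h (fun v => if H.Reachable v₀ v then 0 else 1) (if_pos (.refl v₀)) fun u w huw => by
    have hiff : H.Reachable v₀ u ↔ H.Reachable v₀ w :=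
      ⟨fun h => h.trans huw.reachable, fun h => h.trans huw.symm.reachable⟩
    simp only [hiff]
  have hv₀ : ∀ v, H.Reachable v₀ v := fun v => by simpa using congrFun hind v
  exact ⟨fun u w => (hv₀ u).symm.trans (hv₀ w)⟩

variable {V : Type*} {G : SimpleGraph V}

/-- The spanning subgraph of `G` with edge set `T`. -/
abbrev edgeSubgraph (T : Finset G.edgeSet) : SimpleGraph V :=
  SimpleGraph.fromEdgeSet ((fun e : G.edgeSet => (e : Sym2 V)) '' (T : Set G.edgeSet))

theorem edgeSet_edgeSubgraph (T : Finset G.edgeSet) :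
    (edgeSubgraph T).edgeSet = (fun e : G.edgeSet => (e : Sym2 V)) '' (T : Set G.edgeSet) := by
  rw [SimpleGraph.edgeSet_fromEdgeSet, sdiff_eq_left, Set.disjoint_left]
  rintro _ ⟨e, -, rfl⟩ h
  exact G.not_isDiag_of_mem_edgeSet e.2 h

theorem edgeSubgraph_univ [Fintype G.edgeSet] :
    edgeSubgraph (Finset.univ : Finset G.edgeSet) = G := by
  rw [← SimpleGraph.edgeSet_inj, edgeSet_edgeSubgraph]
  simp

theorem isSpanningTree_iff [Finite V] (T : Finset G.edgeSet) :
    IsSpanningTree G T ↔ (edgeSubgraph T).Connected ∧ T.card + 1 = Nat.card V := by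
  have hcard : Nat.card (edgeSubgraph T).edgeSet = T.card := by
    rw [edgeSet_edgeSubgraph, Nat.card_coe_set_eq,
      Set.ncard_image_of_injective _ Subtype.val_injective, Set.ncard_coe_finset]
  rw [← hcard]
  exact SimpleGraph.isTree_iff_connected_and_card

variable [Fintype V] [DecidableEq V] {R : Type*} [CommRing R]

theorem signedIncidence_mulVec_apply_eq_zero_iff (f : V → R) (e : G.edgeSet) :
    (signedIncidence G R *ᵥ f) e = 0 ↔ ∀ u w, s(u, w) = (e : Sym2 V) → f u = f w := by
  obtain ⟨u, w, -, he, hrow⟩ := exists_signedIncidence_eq R e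
  rw [mulVec, hrow, sub_dotProduct, single_one_dotProduct, single_one_dotProduct, sub_eq_zero, he]
  refine ⟨fun h u' w' h' => ?_, fun h => h u w rfl⟩
  rcases Sym2.eq_iff.mp h' with ⟨rfl, rfl⟩ | ⟨rfl, rfl⟩
  exacts [h, h.symm]

theorem reducedIncidence_mulVec_comp_val {v₀ : V} {f : V → R}
    (hf : f v₀ = 0) :
    reducedIncidence G R v₀ *ᵥ (f ∘ Subtype.val) = signedIncidence G R *ᵥ f := by
  ext e
  simp only [mulVec, dotProduct, Fintype.sum_eq_add_sum_subtype_ne _ v₀, hf, mul_zero, zero_add]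
  rfl

theorem connected_edgeSubgraph_iff (R : Type*) [CommRing R] [Nontrivial R] (v₀ : V)
    (T : Finset G.edgeSet) :
    (edgeSubgraph T).Connected ↔ ∀ g,
      (reducedIncidence G R v₀).submatrix ((↑) : T → G.edgeSet) id *ᵥ g = 0 → g = 0 := by
  have hker : ∀ f : V → R, f v₀ = 0 →
      ((reducedIncidence G R v₀).submatrix ((↑) : T → G.edgeSet) id *ᵥ (f ∘ Subtype.val) = 0 ↔
        ∀ u w, (edgeSubgraph T).Adj u w → f u = f w) := fun f hf => by
    have hrow : ∀ e : T, ((reducedIncidence G R v₀).submatrix ((↑) : T → G.edgeSet) id *ᵥ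
        (f ∘ Subtype.val)) e = (signedIncidence G R *ᵥ f) e := fun e =>
      congrFun (reducedIncidence_mulVec_comp_val (G := G) hf) (e : G.edgeSet)
    simp only [funext_iff, hrow, Pi.zero_apply, signedIncidence_mulVec_apply_eq_zero_iff,
      ← SimpleGraph.mem_edgeSet (edgeSubgraph T), edgeSet_edgeSubgraph]
    exact ⟨fun h u w ⟨e, he, heq⟩ => h ⟨e, he⟩ u w heq.symm,
      fun h e u w heq => h u w ⟨e, e.2, heq.symm⟩⟩
  have hext : ∀ g : {v // v ≠ v₀} → R, ∃ f : V → R, f v₀ = 0 ∧ f ∘ Subtype.val = g := fun g =>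
    ⟨Function.extend Subtype.val g 0, by simp, Function.extend_comp Subtype.val_injective g 0⟩
  rw [connected_iff_forall_eq_zero _ v₀ R]
  refine ⟨fun h g hg => ?_, fun h f hf₀ hf => ?_⟩
  · obtain ⟨f, hf₀, rfl⟩ := hext g
    rw [h f hf₀ ((hker f hf₀).mp hg)]
    rfl
  · have hg := h _ ((hker f hf₀).mpr hf)
    funext v
    obtain rfl | hv := eq_or_ne v v₀
    · exact hf₀
    · exact congrFun hg ⟨v, hv⟩

end Connectivity

section MatrixTree

variable {V : Type*} [Fintype V] [DecidableEq V] {G : SimpleGraph V}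

theorem card_subtype_ne_add_one (v₀ : V) :
    Fintype.card {v : V // v ≠ v₀} + 1 = Fintype.card V := by
  rw [← Fintype.card_option]
  exact Fintype.card_congr (Equiv.optionSubtypeNe v₀)

theorem isUnit_det_reducedIncidence_submatrix {v₀ : V} {T : Finset G.edgeSet}
    (φ : {v : V // v ≠ v₀} ≃ T) (hT : (edgeSubgraph T).Connected) :
    IsUnit (((reducedIncidence G ℤ v₀).submatrix ((↑) : T → G.edgeSet) id).submatrix φ id).det := by
  -- The connectivity criterion holds over every field, so no prime divides the determinant.
  refine Int.isUnit_iff_natAbs_eq.mpr ?_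
  by_contra hdet
  obtain ⟨p, hp, hdvd⟩ := Nat.exists_prime_and_dvd hdet
  have : Fact p.Prime := ⟨hp⟩
  have hne := (det_submatrix_equiv_ne_zero_iff φ).mpr
    ((connected_edgeSubgraph_iff (ZMod p) v₀ T).mp hT)
  apply hne
  rw [← reducedIncidence_map (Int.castRingHom (ZMod p)), submatrix_map, submatrix_map,
    ← RingHom.mapMatrix_apply, ← RingHom.map_det, eq_intCast, ZMod.intCast_zmod_eq_zero_iff_dvd]
  exact Int.natCast_dvd.mpr hdvd

theorem det_weightedGram_submatrix_reducedIncidence_int {v₀ : V} {T : Finset G.edgeSet}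
    (hcard : T.card = Fintype.card {v : V // v ≠ v₀}) [Decidable (edgeSubgraph T).Connected] :
    (weightedGram ((reducedIncidence G ℤ v₀).submatrix ((↑) : T → G.edgeSet) id) 1).det =
      if (edgeSubgraph T).Connected then 1 else 0 := by
  have φ : {v : V // v ≠ v₀} ≃ T := Fintype.equivOfCardEq (by rw [Fintype.card_coe, hcard])
  rw [det_weightedGram_one_eq_sq _ φ]
  split_ifs with hT
  · exact Int.isUnit_sq (isUnit_det_reducedIncidence_submatrix φ hT)
  · rw [connected_edgeSubgraph_iff ℤ v₀ T, ← det_submatrix_equiv_ne_zero_iff φ, not_not] at hT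
    rw [hT, zero_pow two_ne_zero]

theorem det_weightedGram_submatrix_reducedIncidence (R : Type*) [CommRing R] {v₀ : V}
    {T : Finset G.edgeSet} (hcard : T.card = Fintype.card {v : V // v ≠ v₀})
    [Decidable (edgeSubgraph T).Connected] :
    (weightedGram ((reducedIncidence G R v₀).submatrix ((↑) : T → G.edgeSet) id) 1).det =
      if (edgeSubgraph T).Connected then 1 else 0 := by
  have h := congrArg (Int.castRingHom R) (det_weightedGram_submatrix_reducedIncidence_int hcard)
  rw [RingHom.map_det, RingHom.mapMatrix_apply, ← weightedGram_map, ← submatrix_map,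
    reducedIncidence_map, apply_ite (Int.castRingHom R), map_one, map_zero] at h
  convert h
  ext e
  simp

open Classical in
theorem det_weightedGram_reducedIncidence {R : Type*} [CommRing R] [Fintype G.edgeSet] (v₀ : V)
    (x : G.edgeSet → R) :
    (weightedGram (reducedIncidence G R v₀) x).det =
      ∑ T : Finset G.edgeSet with IsSpanningTree G T, ∏ e ∈ T, x e := by
  have htree : ∀ T : Finset G.edgeSet, IsSpanningTree G T ↔
      T.card = Fintype.card {v : V // v ≠ v₀} ∧ (edgeSubgraph T).Connected := fun T => by
    rw [isSpanningTree_iff, Nat.card_eq_fintype_card, ← card_subtype_ne_add_one v₀,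
      Nat.add_right_cancel_iff, and_comm]
  have hterm : ∀ T ∈ Finset.powersetCard (Fintype.card {v : V // v ≠ v₀}) Finset.univ,
      (∏ e ∈ T, x e) *
        (weightedGram ((reducedIncidence G R v₀).submatrix ((↑) : T → G.edgeSet) id) 1).det =
      if (edgeSubgraph T).Connected then ∏ e ∈ T, x e else 0 := fun T hT => by
    rw [det_weightedGram_submatrix_reducedIncidence R (Finset.mem_powersetCard.mp hT).2, mul_ite,
      mul_one, mul_zero]
  rw [det_weightedGram, Finset.sum_congr rfl hterm, ← Finset.sum_filter]
  exact Finset.sum_congr (by ext T; simp [htree]) fun T _ => rfl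

theorem kirchhoffPolynomial_eq_gramPolynomial [Fintype G.edgeSet] (v₀ : V) :
    kirchhoffPolynomial G = gramPolynomial (reducedIncidence G ℝ v₀) := by
  rw [gramPolynomial, reducedIncidence_map, det_weightedGram_reducedIncidence, kirchhoffPolynomial]

theorem injective_mulVec_reducedIncidence (R : Type*) [CommRing R] [Nontrivial R]
    (hG : G.Connected) (v₀ : V) : Function.Injective (reducedIncidence G R v₀).mulVec := by
  have := Fintype.ofFinite G.edgeSet
  have hker := (connected_edgeSubgraph_iff R v₀ Finset.univ).mp
    (by rwa [edgeSubgraph_univ (G := G)])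
  refine (injective_iff_map_eq_zero (reducedIncidence G R v₀).mulVecLin).mpr fun g hg => hker g ?_
  exact funext fun e => congrFun hg (e : G.edgeSet)

end MatrixTree

end GraphLefschetz

theorem theorem5p9_general {V : Type*} [Fintype V] [DecidableEq V] (G : SimpleGraph V)
    [Fintype G.edgeSet] (v₀ : V) {r : ℕ} (hV : Fintype.card V = r + 1) (hr : 2 ≤ r)
    (a : G.edgeSet → ℝ)
    (ha : (GraphLefschetz.weightedGram (GraphLefschetz.reducedIncidence G ℝ v₀) a).PosDef) :
    GraphLefschetz.StrongLefschetzAt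
      (GraphLefschetz.gradedPiece (GraphLefschetz.kirchhoffPolynomial G)) r 1
      (GraphLefschetz.linearElement (GraphLefschetz.kirchhoffPolynomial G) a) := by
  have hcard : Fintype.card {v : V // v ≠ v₀} = r := by
    have := GraphLefschetz.card_subtype_ne_add_one v₀
    omega
  subst hcard
  rw [GraphLefschetz.kirchhoffPolynomial_eq_gramPolynomial v₀]
  exact GraphLefschetz.strongLefschetzAt_one_gramPolynomial hr
    (GraphLefschetz.linearIndependent_vecMulVec_reducedIncidence v₀) ha

theorem theorem5p9 {V : Type*} [Fintype V] (G : SimpleGraph V) [Fintype G.edgeSet]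
    (hG : G.Connected) (r n : ℕ)
    (hV : Fintype.card V = r + 1) (hr : 3 ≤ r + 1)
    (hE : Fintype.card G.edgeSet = n) (hn : 3 ≤ n)
    (a : G.edgeSet → ℝ) (ha : ∀ e, 0 < a e) :
    GraphLefschetz.StrongLefschetzAt
      (GraphLefschetz.gradedPiece (GraphLefschetz.kirchhoffPolynomial G)) r 1
      (GraphLefschetz.linearElement (GraphLefschetz.kirchhoffPolynomial G) a) := by
  classical
  obtain ⟨v₀⟩ := hG.nonempty
  exact theorem5p9_general G v₀ hV (by omega) a (GraphLefschetz.posDef_weightedGram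
    (GraphLefschetz.injective_mulVec_reducedIncidence ℝ hG v₀) ha)
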